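/- Let $X$ be a complex Banach space and let $Q$ be a bounded linear operator on $X$ with spectrum $\sigma(Q)=\{0\}$. Put $$\mathcal G_Q=\Big\{z\in\mathbb C:\ \limsup_{t\to+\infty}\|e^{tzQ}\|<\infty\Big\},\qquad \mathcal R_Q=\Big\{z\in\mathbb C:\ \sup_{\operatorname{Re}s>-1/2}\|(I-szQ)^{-1}\|<\infty\Big\},$$ and let $\mathcal G_Q^\circ$ be the interior of $\mathcal G_Q$ in $\mathbb C$. A strongly continuous semigroup $(S(t))_{t\ge0}$ on $X$ is called a bounded analytic semigroup of angle $\theta\in(0,\pi/2]$ if for every $\theta'\in(0,\theta)$ it has a bounded analytic extension to the sector $\{re^{i\theta_0}: r>0,\ |\theta_0|<\theta'\}$. For every $z\in\mathbb C$ (with $z\neq0$ in the case $Q=0$) the following are equivalent: 1. $z\in\mathcal G_Q^\circ$; 2. $z\ne0$ and the operator $zQ$ generates a bounded analytic semigroup of some angle in $(0,\pi/2]$, namely $t\mapsto e^{tzQ}$; 3. $z\in\mathcal R_Q\setminus\{0\}$. Moreover, $\mathcal R_Q=\mathcal G_Q^\circ\cup\{0\}$, and $\mathcal R_Q=\{0\}$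 if and only if $\mathcal G_Q\subset e^{i\phi}[0,\infty)$ for some $\phi\in[-\pi,\pi)$. -/

import Mathlib

open scoped NNReal Topology

noncomputable section

namespace QuasiSemigroup

variable {X : Type*} [NormedAddCommGroup X] [NormedSpace ℂ X]

/-- The set `𝒢_Q` of all `z ∈ ℂ` with `limsup_{t → +∞} ‖exp (t z Q)‖ < ∞`
(the upper limit is taken in `[0, ∞]`). -/
def setG (Q : X →L[ℂ] X) : Set ℂ :=
  {z : ℂ | Filter.limsup
    (fun t : ℝ => ‖NormedSpace.exp (((t : ℂ) * z) • Q)‖ₑ) Filter.atTop < ⊤}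

/-- The Ritt set `ℛ_Q` of all `z ∈ ℂ` with `sup_{Re s > -1/2} ‖(1 - s z Q)⁻¹‖ < ∞`
(the supremum is taken in `[0, ∞]`). All the inverses exist when the spectrum of `Q` is `{0}`. -/
def setR (Q : X →L[ℂ] X) : Set ℂ :=
  {z : ℂ | ⨆ (s : ℂ) (_ : -(1 / 2 : ℝ) < s.re),
    ‖Ring.inverse (1 - (s * z) • Q)‖ₑ < ⊤}

/-- The balanced open sector `{r e^{i θ₀} : r > 0, -θ < θ₀ < θ}`. -/
def sector (θ : ℝ) : Set ℂ :=
  {w : ℂ | ∃ r θ₀ : ℝ, 0 < r ∧ -θ < θ₀ ∧ θ₀ < θ ∧ w = r * Complex.exp (θ₀ * Complex.I)}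

/-- The closed ray `e^{i φ} [0, ∞)`. -/
def closedRay (φ : ℝ) : Set ℂ :=
  {w : ℂ | ∃ r : ℝ, 0 ≤ r ∧ w = r * Complex.exp (φ * Complex.I)}

/-- A strongly continuous one-parameter semigroup of bounded operators. -/
structure IsC0Semigroup (S : ℝ≥0 → X →L[ℂ] X) : Prop where
  map_zero : S 0 = 1
  map_add : ∀ s t : ℝ≥0, S (s + t) = S s * S t
  strongly_continuous : ∀ x : X, Continuous fun t : ℝ≥0 => S t x

/-- The everywhere defined operator `A` is the infinitesimal generator of the
strongly continuous semigroup `S`. -/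
structure IsGeneratedBy (S : ℝ≥0 → X →L[ℂ] X) (A : X →L[ℂ] X) : Prop where
  semigroup : IsC0Semigroup S
  generator : ∀ x : X, Filter.Tendsto
    (fun t : ℝ≥0 => (((t : ℝ) : ℂ)⁻¹) • (S t x - x)) (𝓝[>] 0) (𝓝 (A x))

/-- A bounded analytic semigroup of angle `θ ∈ (0, π/2]`: a strongly continuous semigroup which
has, for every `θ' ∈ (0, θ)`, a bounded analytic extension to the sector of half-angle `θ'`. -/
structure IsBoundedAnalyticSemigroup (S : ℝ≥0 → X →L[ℂ] X) (θ : ℝ) : Prop where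
  semigroup : IsC0Semigroup S
  angle_pos : 0 < θ
  angle_le : θ ≤ Real.pi / 2
  extension : ∀ θ' : ℝ, 0 < θ' → θ' < θ →
    ∃ F : ℂ → X →L[ℂ] X,
      DifferentiableOn ℂ F (sector θ') ∧
      (∃ C : ℝ, ∀ w ∈ sector θ', ‖F w‖ ≤ C) ∧
      ∀ t : ℝ≥0, 0 < t → F ((t : ℝ) : ℂ) = S t

/-- The family `t ↦ exp (t A)`, `t ≥ 0`. -/
def expSemigroup (A : X →L[ℂ] X) (t : ℝ≥0) : X →L[ℂ] X :=
  NormedSpace.exp (((t : ℝ) : ℂ) • A)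

/-- `A` generates a bounded analytic semigroup (of some angle), namely `t ↦ exp (t A)`. -/
def GeneratesBoundedAnalyticSemigroup (A : X →L[ℂ] X) : Prop :=
  IsGeneratedBy (expSemigroup A) A ∧ ∃ θ : ℝ, IsBoundedAnalyticSemigroup (expSemigroup A) θ

end QuasiSemigroup

end

/-! All three conditions reduce to resolvent estimates for `A = z • Q`, where quasinilpotence makes
every `1 - s • A` invertible. If z is interior to 𝒢_Q, then exp(tA) is bounded on two rays through 1
± iε. Laplace transforms along them bound (1 - sA)⁻¹ on the half-plane Re s > -1/2
(`exists_norm_inverse_le_of_exp_bound`). Conversely, s = w/(1 - w) turns that bound into Ritt's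
condition for 1 + A on the unit disc. Hence 1 + A is power bounded (`exists_norm_pow_le`) and
exp(tA) = e⁻ᵗ exp(t(1 + A)) is bounded, so ℛ_Q ⊆ 𝒢_Q. A perturbation argument shows that ℛ_Q is a
neighbourhood of each of its nonzero points, so these are interior to 𝒢_Q. Boundedness on the two
rays passes to the cone they span, which yields the analytic semigroup; the identity theorem gives
the converse. For the ray criterion, 𝒢_Q is a convex cone that contains no opposite nonzero points
unless Q = 0 (Gelfand, `eq_zero_of_exp_bound`). With empty interior it cannot leave a ray. -/

namespace QuasiSemigroup

/-! ### From exponential bounds to resolvent bounds; Gelfand's theorem. -/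

section BanachAlgebra

variable {𝔸 : Type*} [NormedRing 𝔸] [NormedAlgebra ℂ 𝔸]

theorem inverse_eq_of_mul_eq_one {R : Type*} [MonoidWithZero R] {a b : R} (h : a * b = 1)
    (h' : b * a = 1) : Ring.inverse a = b :=
  Ring.inverse_unit ⟨a, b, h, h'⟩

theorem inverse_smul_of_isUnit {u : 𝔸} (hu : IsUnit u) {c : ℂ} (hc : c ≠ 0) :
    Ring.inverse (c • u) = c⁻¹ • Ring.inverse u := by
  apply inverse_eq_of_mul_eq_one
  · rw [smul_mul_smul_comm, mul_inv_cancel₀ hc, Ring.mul_inverse_cancel _ hu, one_smul]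
  · rw [smul_mul_smul_comm, inv_mul_cancel₀ hc, Ring.inverse_mul_cancel _ hu, one_smul]

variable [CompleteSpace 𝔸]

theorem exp_add_smul (A : 𝔸) (a b : ℂ) :
    NormedSpace.exp ((a + b) • A) = NormedSpace.exp (a • A) * NormedSpace.exp (b • A) := by
  let _ : NormedAlgebra ℚ 𝔸 := NormedAlgebra.restrictScalars ℚ ℂ 𝔸
  rw [add_smul, NormedSpace.exp_add_of_commute]
  exact ((Commute.refl A).smul_left a).smul_right b

theorem exp_smul_one_add (A : 𝔸) (c : ℂ) :
    NormedSpace.exp (c • (1 : 𝔸) + A) = Complex.exp c • NormedSpace.exp A := by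
  let _ : NormedAlgebra ℚ 𝔸 := NormedAlgebra.restrictScalars ℚ ℂ 𝔸
  rw [NormedSpace.exp_add_of_commute ((Commute.one_left A).smul_left c),
    ← Algebra.algebraMap_eq_smul_one, ← NormedSpace.algebraMap_exp_comm, Complex.exp_eq_exp_ℂ,
    Algebra.algebraMap_eq_smul_one, smul_mul_assoc, one_mul]

theorem continuous_exp_smul (A : 𝔸) : Continuous fun c : ℂ => NormedSpace.exp (c • A) :=
  (differentiable_exp_smul_const ℂ A).continuous

/-- The inverse of `B` is the Laplace transform at `0` of `exp (-t B)`, hence bounded by the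
integral of any exponentially decaying bound of that family. -/
theorem norm_inverse_le_of_exp_bound {B : 𝔸} (hB : IsUnit B) {M c : ℝ} (hc : 0 < c)
    (h : ∀ t : ℝ, 0 ≤ t → ‖NormedSpace.exp ((t : ℂ) • (-B))‖ ≤ M * Real.exp (-(c * t))) :
    ‖Ring.inverse B‖ ≤ M / c := by
  -- B⁻¹ - B⁻¹ exp(-tB) is the primitive of exp(-tB) vanishing at 0, so the mean value inequality
  -- estimates it at finite t; the remaining term decays as t → ∞.
  have key : ∀ t : ℝ, 0 ≤ t →
      ‖Ring.inverse B‖ ≤ M / c + (‖Ring.inverse B‖ * M - M / c) * Real.exp (-(c * t)) := by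
    intro t ht
    have hd : ∀ x : ℝ, HasDerivAt
        (fun x : ℝ => Ring.inverse B - Ring.inverse B * NormedSpace.exp ((x : ℂ) • (-B)))
        (NormedSpace.exp ((x : ℂ) • (-B))) x := by
      intro x
      have h1 : HasDerivAt (fun u : ℂ => NormedSpace.exp (u • (-B)))
        ((-B) * NormedSpace.exp ((x : ℂ) • (-B))) (x : ℂ) := hasDerivAt_exp_smul_const' (-B) (x : ℂ)
      have h2 : HasDerivAt (fun u : ℝ => NormedSpace.exp ((u : ℂ) • (-B)))
        ((-B) * NormedSpace.exp ((x : ℂ) • (-B))) x := by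
        simpa [Function.comp_def] using h1.scomp x Complex.ofRealCLM.hasDerivAt
      refine ((h2.const_mul (Ring.inverse B)).const_sub (Ring.inverse B)).congr_deriv ?_
      rw [neg_mul, mul_neg, neg_neg, ← mul_assoc, Ring.inverse_mul_cancel _ hB, one_mul]
    have hb : ∀ x : ℝ, HasDerivAt (fun x : ℝ => M / c * (1 - Real.exp (-(c * x))))
        (M * Real.exp (-(c * x))) x := by
      intro x
      have h1 : HasDerivAt (fun x : ℝ => -(c * x)) (-c) x := by
        simpa using (hasDerivAt_id x).const_mul (-c)
      refine ((h1.exp.const_sub 1).const_mul (M / c)).congr_deriv ?_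
      field_simp
    have := image_norm_le_of_norm_deriv_right_le_deriv_boundary (a := 0) (b := t)
      (fun x _ => (hd x).continuousAt.continuousWithinAt)
      (fun x _ => (hd x).hasDerivWithinAt) (by simp) hb (fun x hx => h x hx.1)
      (Set.right_mem_Icc.2 ht)
    calc ‖Ring.inverse B‖
        = ‖(Ring.inverse B - Ring.inverse B * NormedSpace.exp ((t : ℂ) • (-B)))
            + Ring.inverse B * NormedSpace.exp ((t : ℂ) • (-B))‖ := by rw [sub_add_cancel]
      _ ≤ M / c * (1 - Real.exp (-(c * t))) + ‖Ring.inverse B‖ * (M * Real.exp (-(c * t))) := by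
          refine (norm_add_le _ _).trans (add_le_add this ((norm_mul_le _ _).trans ?_))
          exact mul_le_mul_of_nonneg_left (h t ht) (norm_nonneg _)
      _ = _ := by ring
  have hlim : Filter.Tendsto (fun t : ℝ => M / c +
      (‖Ring.inverse B‖ * M - M / c) * Real.exp (-(c * t))) Filter.atTop
      (𝓝 (M / c + (‖Ring.inverse B‖ * M - M / c) * 0)) := by
    refine Filter.Tendsto.const_add _ (Filter.Tendsto.const_mul _ ?_)
    exact Real.tendsto_exp_neg_atTop_nhds_zero.comp (Filter.tendsto_id.const_mul_atTop hc)
  rw [mul_zero, add_zero] at hlim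
  exact ge_of_tendsto hlim ((Filter.eventually_ge_atTop 0).mono key)

/-- Scaling by η rotates the Laplace integral: exp(-tη(1 - sA)) = e^(-tη) exp(tηsA) decays at rate
Re η. Each application picks η so that ηs falls on a ray where the exponential is bounded. -/
theorem norm_inverse_one_sub_smul_le {A : 𝔸} {s η : ℂ} (hu : IsUnit (1 - s • A))
    (hη : 0 < η.re) {M : ℝ}
    (h : ∀ t : ℝ, 0 ≤ t → ‖NormedSpace.exp (((t : ℂ) * (η * s)) • A)‖ ≤ M) :
    ‖Ring.inverse (1 - s • A)‖ ≤ ‖η‖ * (M / η.re) := by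
  have hη0 : η ≠ 0 := by rintro rfl; simp at hη
  have hB : IsUnit (η • (1 - s • A)) := by
    simpa [Units.smul_def] using hu.smul (Units.mk0 η hη0)
  have hbd := norm_inverse_le_of_exp_bound (M := M) hB hη (fun t ht => by
    have e : (t : ℂ) • (-(η • (1 - s • A))) = (-(t * η)) • (1 : 𝔸) + (t * (η * s)) • A := by
      module
    rw [e, exp_smul_one_add, norm_smul, Complex.norm_exp, mul_comm]
    have e2 : (-((t : ℂ) * η)).re = -(η.re * t) := by simp [mul_comm]
    rw [e2]
    exact mul_le_mul_of_nonneg_right (h t ht) (Real.exp_pos _).le)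
  rw [inverse_smul_of_isUnit hu hη0, norm_smul, norm_inv] at hbd
  rwa [inv_mul_le_iff₀ (norm_pos_iff.2 hη0)] at hbd

theorem differentiable_inverse_one_sub_smul {A : 𝔸} (hA : ∀ s : ℂ, IsUnit (1 - s • A)) :
    Differentiable ℂ fun s : ℂ => Ring.inverse (1 - s • A) := fun s =>
  DifferentiableAt.inverse (by fun_prop) (hA s)

/-- If `exp (t A)` is bounded on the two rays through `1 ± ε i`, then the resolvents satisfy
Ritt's condition. -/
theorem exists_norm_inverse_le_of_exp_bound {A : 𝔸} (hA : ∀ s : ℂ, IsUnit (1 - s • A))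
    {ε M : ℝ} (hε : 0 < ε) (hε1 : ε ≤ 1)
    (h₁ : ∀ t : ℝ, 0 ≤ t → ‖NormedSpace.exp (((t : ℂ) * (1 + ε * Complex.I)) • A)‖ ≤ M)
    (h₂ : ∀ t : ℝ, 0 ≤ t → ‖NormedSpace.exp (((t : ℂ) * (1 - ε * Complex.I)) • A)‖ ≤ M) :
    ∃ C : ℝ, ∀ s : ℂ, -(1 / 2 : ℝ) < s.re → ‖Ring.inverse (1 - s • A)‖ ≤ C := by
  obtain ⟨K, hK⟩ := (isCompact_closedBall (0 : ℂ) (2 / ε)).exists_bound_of_continuousOn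
    (differentiable_inverse_one_sub_smul hA).continuous.continuousOn
  have hM : 0 ≤ M := (norm_nonneg _).trans (h₁ 0 le_rfl)
  -- K covers the compact disc ‖s‖ ≤ 2/ε; Laplace transforms cover the rest.
  refine ⟨max K (4 * M / ε), fun s hs => ?_⟩
  rcases le_or_gt ‖s‖ (2 / ε) with hsmall | hlarge
  · exact (hK s (by simpa using hsmall)).trans (le_max_left _ _)
  · refine le_trans ?_ (le_max_right _ _)
    have hs0 : 0 < ‖s‖ := lt_trans (by positivity) hlarge
    have hlarge' : 2 < ε * ‖s‖ := by rwa [div_lt_iff₀ hε, mul_comm] at hlarge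
    have hone : ε * 1 ≤ ε * ‖s‖ := by
      refine mul_le_mul_of_nonneg_left ?_ hε.le
      nlinarith
    obtain ⟨δ, hδ, hδM, hδs⟩ : ∃ δ : ℝ, |δ| = ε ∧
        (∀ t : ℝ, 0 ≤ t → ‖NormedSpace.exp (((t : ℂ) * (1 + δ * Complex.I)) • A)‖ ≤ M) ∧
        δ * s.im = ε * |s.im| := by
      rcases le_total 0 s.im with him | him
      · exact ⟨ε, abs_of_pos hε, h₁, by rw [abs_of_nonneg him]⟩
      · refine ⟨-ε, by rw [abs_neg, abs_of_pos hε], fun t ht => ?_, by rw [abs_of_nonpos him]; ring⟩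
        simpa [sub_eq_add_neg] using h₂ t ht
    -- Then ηs = |s|²(1 + iδ) lies on a bounded ray, and the sign of δ makes Im s contribute
    -- positively to Re η.
    set η : ℂ := (starRingEnd ℂ) s * (1 + δ * Complex.I) with hηdef
    have hηre : η.re = s.re + ε * |s.im| := by
      rw [← hδs]; simp [hηdef]; ring
    have hηnorm : ‖η‖ ≤ 2 * ‖s‖ := by
      rw [hηdef, norm_mul, Complex.norm_conj, mul_comm]
      refine mul_le_mul_of_nonneg_right ((norm_add_le _ _).trans ?_) hs0.le
      simp only [norm_one, norm_mul, Complex.norm_real, Real.norm_eq_abs, hδ, Complex.norm_I]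
      linarith
    -- When Re s < 0, the loss is at most (1 + ε)/2 ≤ 1, which ε‖s‖ > 2 absorbs.
    have hηlow : ε / 2 * ‖s‖ ≤ η.re := by
      rw [hηre]
      have htri : ε * ‖s‖ ≤ ε * |s.re| + ε * |s.im| := by
        rw [← mul_add]
        exact mul_le_mul_of_nonneg_left (Complex.norm_le_abs_re_add_abs_im s) hε.le
      rcases le_total 0 s.re with hre | hre
      · rw [abs_of_nonneg hre] at htri
        nlinarith
      · rw [abs_of_nonpos hre] at htri
        nlinarith
    have hηpos : 0 < η.re := lt_of_lt_of_le (by positivity) hηlow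
    refine (norm_inverse_one_sub_smul_le (M := M) (hA s) hηpos fun t ht => ?_).trans ?_
    · have e : (t : ℂ) * (η * s) = ((t * Complex.normSq s : ℝ) : ℂ) * (1 + δ * Complex.I) := by
        rw [hηdef, Complex.ofReal_mul, ← Complex.mul_conj s]; ring
      rw [e]
      exact hδM _ (mul_nonneg ht (Complex.normSq_nonneg _))
    · calc ‖η‖ * (M / η.re) ≤ 2 * ‖s‖ * (M / (ε / 2 * ‖s‖)) := by gcongr
        _ = 4 * M / ε := by field_simp; ring

/-- **Gelfand's theorem**: a quasinilpotent element generating a bounded group is zero. -/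
theorem eq_zero_of_exp_bound {A : 𝔸} (hA : ∀ s : ℂ, IsUnit (1 - s • A)) {M : ℝ}
    (h : ∀ t : ℝ, ‖NormedSpace.exp ((t : ℂ) • A)‖ ≤ M) : A = 0 := by
  have hM : 0 ≤ M := (norm_nonneg _).trans (h 0)
  have hdiff := differentiable_inverse_one_sub_smul hA
  -- Taking η = ± conj s bounds the resolvent by M|s|/|Re s|, singular at ±ir. The factor 1 + s²/r²
  -- has modulus 2|Re s|/r on the circle and cancels the singularity.
  have hcirc : ∀ r : ℝ, 0 < r → ∀ s : ℂ, ‖s‖ = r →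
      ‖(1 + s ^ 2 / (r : ℂ) ^ 2) • Ring.inverse (1 - s • A)‖ ≤ 2 * M := by
    intro r hr s hs
    have hrC : (r : ℂ) ≠ 0 := by exact_mod_cast hr.ne'
    have hrr : s * (starRingEnd ℂ) s = (r : ℂ) ^ 2 := by
      rw [Complex.mul_conj, Complex.normSq_eq_norm_sq, hs]; push_cast; ring
    have hfac : 1 + s ^ 2 / (r : ℂ) ^ 2 = (2 * s.re : ℝ) * s / (r : ℂ) ^ 2 := by
      rw [← Complex.add_conj, eq_div_iff (pow_ne_zero 2 hrC), add_mul, div_mul_cancel₀ _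
        (pow_ne_zero 2 hrC), ← hrr]
      ring
    have hnf : ‖1 + s ^ 2 / (r : ℂ) ^ 2‖ = 2 * |s.re| / r := by
      rw [hfac]
      simp only [norm_div, norm_mul, norm_pow, Complex.norm_real, Real.norm_eq_abs, hs,
        abs_of_pos hr, abs_two]
      field_simp
    rw [norm_smul, hnf]
    rcases eq_or_ne s.re 0 with h0 | h0
    · simp [h0, hM]
    · have hpos : 0 < |s.re| := abs_pos.2 h0
      obtain ⟨σ, hσ, hσs⟩ : ∃ σ : ℝ, |σ| = 1 ∧ σ * s.re = |s.re| := by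
        rcases lt_or_gt_of_ne h0 with h1 | h1
        · exact ⟨-1, by simp, by rw [abs_of_neg h1]; ring⟩
        · exact ⟨1, by simp, by rw [abs_of_pos h1]; ring⟩
      have hre : ((σ : ℂ) * (starRingEnd ℂ) s).re = |s.re| := by rw [← hσs]; simp
      have := norm_inverse_one_sub_smul_le (M := M) (η := σ * (starRingEnd ℂ) s) (hA s)
        (by rw [hre]; exact hpos) (fun t _ => by
          have e : (t : ℂ) * (σ * (starRingEnd ℂ) s * s) = ((t * (σ * r ^ 2) : ℝ) : ℂ) := by
            push_cast; rw [← hrr]; ring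
          rw [e]; exact h _)
      rw [hre, norm_mul, Complex.norm_conj, hs, Complex.norm_real, Real.norm_eq_abs, hσ,
        one_mul] at this
      calc 2 * |s.re| / r * ‖Ring.inverse (1 - s • A)‖
          ≤ 2 * |s.re| / r * (r * (M / |s.re|)) := by gcongr
        _ = 2 * M := by field_simp
  have hbd : ∀ s : ℂ, ‖Ring.inverse (1 - s • A)‖ ≤ 4 * M := by
    intro s
    -- A radius beyond 2‖s‖ keeps the factor 1 + s²/r² at least 1/2 in modulus at s, so the maximum
    -- principle bounds the resolvent itself.
    set r : ℝ := 2 * ‖s‖ + 1 with hrdef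
    have hr : 0 < r := by positivity
    have hmax : ‖(1 + s ^ 2 / (r : ℂ) ^ 2) • Ring.inverse (1 - s • A)‖ ≤ 2 * M := by
      refine Complex.norm_le_of_forall_mem_frontier_norm_le (U := Metric.ball (0 : ℂ) r)
        (f := fun s => (1 + s ^ 2 / (r : ℂ) ^ 2) • Ring.inverse (1 - s • A))
        Metric.isBounded_ball (Differentiable.diffContOnCl ?_) ?_ (subset_closure ?_)
      · have hfac : Differentiable ℂ fun s : ℂ => 1 + s ^ 2 / (r : ℂ) ^ 2 := by fun_prop
        exact hfac.smul hdiff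
      · intro z hz
        rw [frontier_ball _ hr.ne', mem_sphere_zero_iff_norm] at hz
        exact hcirc r hr z hz
      · rw [mem_ball_zero_iff]; linarith [norm_nonneg s]
    have hlow : 1 / 2 ≤ ‖1 + s ^ 2 / (r : ℂ) ^ 2‖ := by
      have h1 : ‖s ^ 2 / (r : ℂ) ^ 2‖ ≤ 1 / 2 := by
        rw [norm_div, norm_pow, norm_pow, Complex.norm_real, Real.norm_of_nonneg hr.le,
          div_le_iff₀ (by positivity)]
        nlinarith [norm_nonneg s]
      have h2 := norm_sub_norm_le (1 : ℂ) (-(s ^ 2 / (r : ℂ) ^ 2))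
      rw [sub_neg_eq_add, norm_neg, norm_one] at h2
      linarith
    rw [norm_smul] at hmax
    nlinarith [norm_nonneg (Ring.inverse (1 - s • A))]
  -- Liouville: the bounded entire resolvent is constant, so (1 - A)⁻¹ = 1.
  have hconst := hdiff.apply_eq_apply_of_bounded (isBounded_iff_forall_norm_le.2
    ⟨4 * M, by rintro _ ⟨s, rfl⟩; exact hbd s⟩) 1 0
  have h1 : Ring.inverse (1 - A) = 1 := by simpa using hconst
  have h2 := Ring.mul_inverse_cancel (1 - A) (by simpa using hA 1)
  rw [h1, mul_one] at h2
  simpa using h2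

end BanachAlgebra

/-! ### Ritt's condition, its stability, and power boundedness. -/

section RittCondition

theorem norm_one_sub_circleMap (ρ θ : ℝ) :
    ‖1 - circleMap 0 ρ θ‖ = ‖circleMap 0 1 θ - (ρ : ℂ)‖ := by
  have h : ∀ a b : ℂ, Complex.normSq a = Complex.normSq b → ‖a‖ = ‖b‖ := fun a b hab => by
    rw [Complex.normSq_eq_norm_sq, Complex.normSq_eq_norm_sq] at hab
    exact (pow_left_inj₀ (norm_nonneg _) (norm_nonneg _) two_ne_zero).1 hab
  apply h
  simp only [circleMap, zero_add, Complex.ofReal_one, one_mul, Complex.normSq_apply,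
    Complex.sub_re, Complex.one_re, Complex.sub_im, Complex.one_im, Complex.re_ofReal_mul,
    Complex.im_ofReal_mul, Complex.exp_ofReal_mul_I_re, Complex.exp_ofReal_mul_I_im,
    Complex.ofReal_re, Complex.ofReal_im]
  linear_combination (ρ ^ 2 - 1) * Real.sin_sq_add_cos_sq θ

theorem one_sub_circleMap_ne_zero {ρ : ℝ} (h0 : 0 ≤ ρ) (h1 : ρ < 1) (θ : ℝ) :
    1 - circleMap 0 ρ θ ≠ 0 := by
  intro h
  have := congrArg norm (sub_eq_zero.1 h)
  rw [norm_one, norm_circleMap_zero, abs_of_nonneg h0] at this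
  linarith

theorem continuous_norm_one_sub_circleMap_inv {ρ : ℝ} (h0 : 0 ≤ ρ) (h1 : ρ < 1) :
    Continuous fun θ : ℝ => (‖1 - circleMap 0 ρ θ‖ ^ 2)⁻¹ := by
  refine Continuous.inv₀ ?_ fun θ =>
    pow_ne_zero 2 (norm_ne_zero_iff.2 (one_sub_circleMap_ne_zero h0 h1 θ))
  exact (continuous_const.sub (continuous_circleMap 0 ρ)).norm.pow 2

/-- The mean of `|1 - w|⁻²` over the circle `|w| = ρ`. -/
theorem integral_norm_one_sub_circleMap_inv {ρ : ℝ} (h0 : 0 ≤ ρ) (h1 : ρ < 1) :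
    (2 * Real.pi)⁻¹ * ∫ θ : ℝ in 0..2 * Real.pi, (‖1 - circleMap 0 ρ θ‖ ^ 2)⁻¹
      = (1 - ρ ^ 2)⁻¹ := by
  -- The Poisson integral of the constant 1, with the pole at ρ; |1 - ρe^(iθ)| = |e^(iθ) - ρ|
  -- matches the kernel's denominator.
  have hP := DiffContOnCl.circleAverage_poissonKernel_smul (R := 1) (c := 0) (w := (ρ : ℂ))
    (f := fun _ : ℂ => (1 : ℂ)) diffContOnCl_const (by simpa [abs_of_nonneg h0] using h1)
  rw [Real.circleAverage_def] at hP
  have hint : (fun θ : ℝ => (poissonKernel 0 (ρ : ℂ) • fun _ : ℂ => (1 : ℂ)) (circleMap 0 1 θ))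
      = fun θ : ℝ => (((1 - ρ ^ 2) * (‖1 - circleMap 0 ρ θ‖ ^ 2)⁻¹ : ℝ) : ℂ) := by
    funext θ
    simp only [Pi.smul_apply', poissonKernel_def, sub_zero, norm_circleMap_zero, abs_one,
      Complex.norm_real, Real.norm_of_nonneg h0, norm_one_sub_circleMap, one_pow,
      Complex.real_smul, mul_one, div_eq_mul_inv]
  rw [hint, intervalIntegral.integral_ofReal, intervalIntegral.integral_const_mul,
    Complex.real_smul, ← Complex.ofReal_mul, ← Complex.ofReal_one, Complex.ofReal_inj] at hP
  have hne : 1 - ρ ^ 2 ≠ 0 := by nlinarith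
  refine eq_inv_of_mul_eq_one_left ?_
  simp only [Complex.ofReal_one] at hP
  refine Eq.trans ?_ hP
  ring

theorem neg_half_lt_re_div_one_sub {w : ℂ} (hw : ‖w‖ < 1) :
    -(1 / 2 : ℝ) < (w / (1 - w)).re := by
  have hne : 1 - w ≠ 0 := by
    intro h
    rw [← sub_eq_zero.1 h, norm_one] at hw
    exact lt_irrefl _ hw
  have hpos : 0 < Complex.normSq (1 - w) := Complex.normSq_pos.2 hne
  have hsq : Complex.normSq w < 1 := by
    rw [Complex.normSq_eq_norm_sq]
    nlinarith [norm_nonneg w]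
  rw [Complex.div_re, ← add_div, lt_div_iff₀ hpos]
  simp only [Complex.normSq_apply, Complex.sub_re, Complex.one_re, Complex.sub_im,
    Complex.one_im] at hsq ⊢
  nlinarith

variable {𝔸 : Type*} [NormedRing 𝔸] [NormedAlgebra ℂ 𝔸]

theorem one_sub_smul_one_add {A : 𝔸} {w : ℂ} (hw : 1 - w ≠ 0) :
    1 - w • (1 + A) = (1 - w) • (1 - (w / (1 - w)) • A) := by
  rw [smul_sub, smul_smul, mul_div_cancel₀ _ hw]
  module

/-- Ritt's condition is stable under small multiplicative perturbations. -/
theorem norm_inverse_one_sub_perturb_le {A : 𝔸} {C : ℝ} {s ε : ℂ} (hs : IsUnit (1 - s • A))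
    (hs' : IsUnit (1 - (s * (1 + ε)) • A)) (hC : ‖Ring.inverse (1 - s • A)‖ ≤ C)
    (hε : ‖ε‖ * (C + ‖(1 : 𝔸)‖) ≤ 1 / 2) :
    ‖Ring.inverse (1 - (s * (1 + ε)) • A)‖ ≤ 2 * C := by
  set R := Ring.inverse (1 - s • A) with hR
  set R' := Ring.inverse (1 - (s * (1 + ε)) • A) with hR'
  have h1 : (1 - s • A) * R = 1 := Ring.mul_inverse_cancel _ hs
  have h2 : R' * (1 - (s * (1 + ε)) • A) = 1 := Ring.inverse_mul_cancel _ hs'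
  -- A resolvent identity with sAR replaced by R - 1, so that no bound on sA is needed; the
  -- smallness of ε then absorbs R' on the right.
  have key : R' = R + ε • (R' * (R - 1)) := by
    have h3 : (s • A) * R = R - 1 := by rw [← h1]; noncomm_ring
    have h4 : R' * (1 - s • A) = 1 + ε • (R' * (s • A)) := by
      have h5 : (s * (1 + ε)) • A = s • A + ε • (s • A) := by module
      rw [h5, mul_sub, mul_add, mul_smul_comm ε, sub_eq_iff_eq_add] at h2
      rw [mul_sub, h2]
      abel
    calc R' = R' * (1 - s • A) * R := by rw [mul_assoc, h1, mul_one]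
      _ = R + ε • (R' * (R - 1)) := by
        rw [h4, add_mul, one_mul, smul_mul_assoc, mul_assoc, h3]
  have hb : ‖R'‖ ≤ C + ‖ε‖ * (‖R'‖ * (C + ‖(1 : 𝔸)‖)) := by
    calc ‖R'‖ = ‖R + ε • (R' * (R - 1))‖ := by rw [← key]
      _ ≤ ‖R‖ + ‖ε‖ * (‖R'‖ * (‖R‖ + ‖(1 : 𝔸)‖)) := by
        refine (norm_add_le _ _).trans (add_le_add le_rfl ?_)
        rw [norm_smul]
        gcongr
        exact (norm_mul_le _ _).trans (mul_le_mul_of_nonneg_left (norm_sub_le _ _) (norm_nonneg _))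
      _ ≤ _ := by gcongr
  nlinarith [norm_nonneg R']

variable [CompleteSpace 𝔸]

/-- Cauchy's estimate for (1 - wT)⁻² = Σ (n + 1) Tⁿ wⁿ. Squaring produces the factor n + 1, while
the mean of C²/|1 - w|² over the circle is only C²/(1 - ρ²). -/
theorem pow_coeff_bound {T : 𝔸} {ρ : ℝ} (hρ : 0 < ρ) (hρ1 : ρ < 1) {C : ℝ}
    (hT : ∀ w : ℂ, ‖w‖ < 1 → IsUnit (1 - w • T) ∧ ‖Ring.inverse (1 - w • T)‖ ≤ C / ‖1 - w‖)
    (n : ℕ) : (n + 1) * ‖T ^ n‖ ≤ C ^ 2 * (1 - ρ ^ 2)⁻¹ * ρ⁻¹ ^ n := by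
  set f : ℂ → 𝔸 := fun w => Ring.inverse (1 - w • T) ^ 2 with hf
  have hball : ∀ w ∈ Metric.closedBall (0 : ℂ) ρ, ‖w‖ < 1 := fun w hw =>
    (mem_closedBall_zero_iff.1 hw).trans_lt hρ1
  have hlin : Differentiable ℂ fun w : ℂ => 1 - w • T := by fun_prop
  have hdiff : DifferentiableOn ℂ f (Metric.closedBall 0 (⟨ρ, hρ.le⟩ : ℝ≥0)) := fun w hw =>
    ((DifferentiableAt.inverse (hlin w) (hT w (hball w hw)).1).pow 2).differentiableWithinAt
  have hps := (hdiff.hasFPowerSeriesOnBall (by exact_mod_cast hρ)).hasFPowerSeriesAt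
  set p : FormalMultilinearSeries ℂ ℂ 𝔸 := fun n =>
    ContinuousMultilinearMap.mkPiRing ℂ (Fin n) (((n : ℂ) + 1) • T ^ n) with hp
  have hpc : ∀ n, p.coeff n = ((n : ℂ) + 1) • T ^ n := fun n => by
    simp [FormalMultilinearSeries.coeff, hp]
  have hps' : HasFPowerSeriesAt f p 0 := by
    rw [hasFPowerSeriesAt_iff]
    have hev : ∀ᶠ w : ℂ in 𝓝 0, ‖w • T‖ < 1 := by
      have : Continuous fun w : ℂ => ‖w • T‖ := by fun_prop
      exact this.continuousAt.eventually (gt_mem_nhds (by simp))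
    filter_upwards [hev] with w hw
    have hterm : (fun k => w ^ k • p.coeff k) =
        fun k : ℕ => (((k + 1).choose 1 : ℕ) : 𝔸) * (w • T) ^ k := by
      funext k
      rw [hpc, Nat.choose_one_right, smul_pow, smul_smul, mul_smul_comm, mul_comm, mul_smul,
        smul_comm]
      rw [← Nat.cast_succ, Nat.cast_smul_eq_nsmul, nsmul_eq_mul]
    rw [hterm, zero_add]
    exact hasSum_choose_mul_geometric_of_norm_lt_one' 1 hw
  have hnorm : ‖((n : ℂ) + 1) • T ^ n‖ = (n + 1) * ‖T ^ n‖ := by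
    rw [norm_smul, ← Nat.cast_succ, Complex.norm_natCast, Nat.cast_succ]
  rw [← hnorm, ← hpc, ← FormalMultilinearSeries.norm_apply_eq_norm_coef,
    ← hps.eq_formalMultilinearSeries hps']
  refine (norm_cauchyPowerSeries_le f 0 ρ n).trans ?_
  rw [abs_of_pos hρ, ← integral_norm_one_sub_circleMap_inv hρ.le hρ1, mul_left_comm,
    ← intervalIntegral.integral_const_mul (C ^ 2)]
  have hpi : 0 ≤ (2 * Real.pi)⁻¹ := inv_nonneg.2 Real.two_pi_pos.le
  refine mul_le_mul_of_nonneg_right (mul_le_mul_of_nonneg_left ?_ hpi)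
    (pow_nonneg (inv_nonneg.2 hρ.le) n)
  have hmem : ∀ θ : ℝ, circleMap 0 ρ θ ∈ Metric.closedBall (0 : ℂ) ρ :=
    fun θ => circleMap_mem_closedBall 0 hρ.le θ
  refine intervalIntegral.integral_mono_on Real.two_pi_pos.le ?_ ?_ fun θ _ => ?_
  · have hcont : Continuous fun θ : ℝ => f (circleMap 0 ρ θ) :=
      hdiff.continuousOn.comp_continuous (continuous_circleMap 0 ρ) hmem
    exact hcont.norm.intervalIntegrable _ _
  · exact (continuous_const.mul
      (continuous_norm_one_sub_circleMap_inv hρ.le hρ1)).intervalIntegrable _ _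
  · refine (norm_pow_le' _ two_pos).trans ?_
    rw [← div_eq_mul_inv, ← div_pow]
    exact pow_le_pow_left₀ (norm_nonneg _) (hT _ (hball _ (hmem θ))).2 2

/-- Under Ritt's condition on the resolvents of `A`, the element `1 + A` is power bounded. -/
theorem exists_norm_pow_le {A : 𝔸} (hA : ∀ s : ℂ, IsUnit (1 - s • A)) {C : ℝ}
    (hC : ∀ s : ℂ, -(1 / 2 : ℝ) < s.re → ‖Ring.inverse (1 - s • A)‖ ≤ C) (n : ℕ) :
    ‖(1 + A) ^ n‖ ≤ 2 * Real.exp 1 * C ^ 2 := by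
  have hT : ∀ w : ℂ, ‖w‖ < 1 →
      IsUnit (1 - w • (1 + A)) ∧ ‖Ring.inverse (1 - w • (1 + A))‖ ≤ C / ‖1 - w‖ := by
    intro w hw
    have hne : 1 - w ≠ 0 := by
      intro h
      rw [← sub_eq_zero.1 h, norm_one] at hw
      exact lt_irrefl _ hw
    rw [one_sub_smul_one_add hne]
    refine ⟨?_, ?_⟩
    · simpa [Units.smul_def] using (hA (w / (1 - w))).smul (Units.mk0 (1 - w) hne)
    · rw [inverse_smul_of_isUnit (hA _) hne, norm_smul, norm_inv, div_eq_inv_mul C]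
      exact mul_le_mul_of_nonneg_left (hC _ (neg_half_lt_re_div_one_sub hw))
        (inv_nonneg.2 (norm_nonneg (1 - w)))
  have hn : (0 : ℝ) < (n : ℝ) + 1 := by positivity
  -- With 1 - ρ = 1/(n + 2), the mean is at most C²(n + 2), comparable to the factor n + 1, while
  -- ρ⁻ⁿ stays below e.
  set ρ : ℝ := ((n : ℝ) + 1) / (n + 2) with hρ
  have hρ0 : 0 < ρ := by positivity
  have hρ1 : ρ < 1 := by rw [hρ, div_lt_one (by positivity : (0 : ℝ) < n + 2)]; linarith
  have hb := pow_coeff_bound hρ0 hρ1 hT n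
  have h1 : (1 - ρ ^ 2)⁻¹ ≤ (n : ℝ) + 2 := by
    rw [inv_le_comm₀ (by nlinarith) (by positivity)]
    have : ((n : ℝ) + 2)⁻¹ = 1 - ρ := by rw [hρ]; field_simp; ring
    rw [this]; nlinarith
  have h2 : ρ⁻¹ ^ n ≤ Real.exp 1 := by
    have h3 : ρ⁻¹ ≤ Real.exp (1 / ((n : ℝ) + 1)) := by
      have : ρ⁻¹ = 1 / ((n : ℝ) + 1) + 1 := by rw [hρ]; field_simp; ring
      rw [this]; exact Real.add_one_le_exp _
    refine (pow_le_pow_left₀ (by positivity) h3 n).trans ?_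
    rw [← Real.exp_nat_mul]
    refine Real.exp_le_exp.2 ?_
    rw [mul_one_div, div_le_one hn]
    linarith
  have h4 : ((n : ℝ) + 1) * ‖(1 + A) ^ n‖ ≤ ((n : ℝ) + 1) * (2 * Real.exp 1 * C ^ 2) := by
    refine hb.trans ?_
    calc C ^ 2 * (1 - ρ ^ 2)⁻¹ * ρ⁻¹ ^ n ≤ C ^ 2 * ((n : ℝ) + 2) * Real.exp 1 := by gcongr
      _ ≤ C ^ 2 * (2 * ((n : ℝ) + 1)) * Real.exp 1 := by gcongr; linarith
      _ = _ := by ring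
  exact le_of_mul_le_mul_left h4 hn

theorem norm_exp_smul_le_of_norm_pow_le {A : 𝔸} {K : ℝ} (hK : ∀ n : ℕ, ‖(1 + A) ^ n‖ ≤ K)
    {t : ℝ} (ht : 0 ≤ t) : ‖NormedSpace.exp ((t : ℂ) • A)‖ ≤ K := by
  have e : (t : ℂ) • A = (-(t : ℂ)) • (1 : 𝔸) + (t : ℂ) • (1 + A) := by module
  have hb : ‖NormedSpace.exp ((t : ℂ) • (1 + A))‖ ≤ Real.exp t * K := by
    rw [NormedSpace.exp_eq_tsum ℂ]
    have hs : HasSum (fun n : ℕ => (t ^ n / n.factorial) * K) (Real.exp t * K) := by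
      rw [Real.exp_eq_exp_ℝ]
      exact (NormedSpace.expSeries_div_hasSum_exp t).mul_right K
    refine tsum_of_norm_bounded hs fun n => ?_
    rw [smul_pow, smul_smul, norm_smul]
    have : ‖((n.factorial : ℂ))⁻¹ * (t : ℂ) ^ n‖ = t ^ n / n.factorial := by
      rw [norm_mul, norm_inv, norm_pow, Complex.norm_natCast, Complex.norm_real,
        Real.norm_of_nonneg ht, div_eq_inv_mul]
    rw [this]
    exact mul_le_mul_of_nonneg_left (hK n) (by positivity)
  rw [e, exp_smul_one_add, norm_smul, Complex.norm_exp, Complex.neg_re, Complex.ofReal_re]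
  calc Real.exp (-t) * ‖NormedSpace.exp ((t : ℂ) • (1 + A))‖
      ≤ Real.exp (-t) * (Real.exp t * K) := by gcongr
    _ = K := by rw [← mul_assoc, ← Real.exp_add]; simp

end RittCondition

/-! ### Geometry of sectors and rays. -/

section Sector

/-- Below a right angle the sector is an intersection of two open half-planes, which gives openness
and convexity. -/
theorem mem_sector_iff {θ : ℝ} (h0 : 0 < θ) (h1 : θ < Real.pi / 2) {w : ℂ} :
    w ∈ sector θ ↔ w.im * Real.cos θ < Real.sin θ * w.re ∧
      -(w.im * Real.cos θ) < Real.sin θ * w.re := by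
  have hs : 0 < Real.sin θ := Real.sin_pos_of_pos_of_lt_pi h0 (by linarith)
  have hc : 0 < Real.cos θ := Real.cos_pos_of_mem_Ioo ⟨by linarith, h1⟩
  constructor
  · rintro ⟨r, θ₀, hr, hl, hu, rfl⟩
    have ha : 0 < Real.sin (θ - θ₀) := Real.sin_pos_of_pos_of_lt_pi (by linarith) (by linarith)
    have hb : 0 < Real.sin (θ + θ₀) := Real.sin_pos_of_pos_of_lt_pi (by linarith) (by linarith)
    rw [Real.sin_sub] at ha
    rw [Real.sin_add] at hb
    simp only [Complex.re_ofReal_mul, Complex.im_ofReal_mul, Complex.exp_ofReal_mul_I_re,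
      Complex.exp_ofReal_mul_I_im]
    have ha' := mul_pos hr ha
    have hb' := mul_pos hr hb
    constructor <;> linarith
  · rintro ⟨ha, hb⟩
    have hre : 0 < w.re := by nlinarith
    have hw : w ≠ 0 := by rintro rfl; simp at hre
    have hwn : 0 < ‖w‖ := norm_pos_iff.2 hw
    have harg := abs_lt.1 (Complex.abs_arg_lt_pi_div_two_iff.2 (Or.inl hre))
    have hwre : w.re = ‖w‖ * Real.cos w.arg := (Complex.norm_mul_cos_arg w).symm
    have hwim : w.im = ‖w‖ * Real.sin w.arg := (Complex.norm_mul_sin_arg w).symm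
    rw [hwre, hwim] at ha hb
    refine ⟨‖w‖, w.arg, hwn, ?_, ?_, (Complex.norm_mul_exp_arg_mul_I w).symm⟩
    · by_contra hcon
      have : Real.sin (θ + w.arg) ≤ 0 :=
        Real.sin_nonpos_of_nonpos_of_neg_pi_le (by linarith) (by linarith)
      rw [Real.sin_add] at this
      nlinarith
    · by_contra hcon
      have : Real.sin (θ - w.arg) ≤ 0 :=
        Real.sin_nonpos_of_nonpos_of_neg_pi_le (by linarith) (by linarith)
      rw [Real.sin_sub] at this
      nlinarith

theorem isOpen_sector {θ : ℝ} (h0 : 0 < θ) (h1 : θ < Real.pi / 2) : IsOpen (sector θ) := by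
  have : sector θ = {w : ℂ | w.im * Real.cos θ < Real.sin θ * w.re} ∩
      {w : ℂ | -(w.im * Real.cos θ) < Real.sin θ * w.re} :=
    Set.ext fun w => mem_sector_iff h0 h1
  rw [this]
  exact (isOpen_lt (by fun_prop) (by fun_prop)).inter (isOpen_lt (by fun_prop) (by fun_prop))

theorem convex_sector {θ : ℝ} (h0 : 0 < θ) (h1 : θ < Real.pi / 2) : Convex ℝ (sector θ) := by
  intro x hx y hy a b ha hb hab
  rw [mem_sector_iff h0 h1] at hx hy ⊢
  simp only [Complex.add_re, Complex.add_im, Complex.real_smul, Complex.re_ofReal_mul,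
    Complex.im_ofReal_mul]
  rcases ha.eq_or_lt with rfl | ha'
  · obtain rfl : b = 1 := by linarith
    constructor <;> linarith
  · constructor
    · nlinarith [mul_lt_mul_of_pos_left hx.1 ha', mul_le_mul_of_nonneg_left hy.1.le hb]
    · nlinarith [mul_lt_mul_of_pos_left hx.2 ha', mul_le_mul_of_nonneg_left hy.2.le hb]

theorem ofReal_mul_mem_sector {θ t : ℝ} (ht : 0 < t) {w : ℂ} (hw : w ∈ sector θ) :
    (t : ℂ) * w ∈ sector θ := by
  obtain ⟨r, θ₀, hr, hl, hu, rfl⟩ := hw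
  exact ⟨t * r, θ₀, mul_pos ht hr, hl, hu, by push_cast; ring⟩

theorem ofReal_mem_sector {θ t : ℝ} (hθ : 0 < θ) (ht : 0 < t) : (t : ℂ) ∈ sector θ :=
  ⟨t, 0, ht, by linarith, hθ, by simp⟩

theorem interior_closedRay (φ : ℝ) : interior (closedRay φ) = ∅ := by
  rw [Set.eq_empty_iff_forall_notMem]
  intro z hz
  obtain ⟨r, -, hr⟩ := interior_subset hz
  have hc : Continuous fun e : ℝ => z + e * (Complex.I * Complex.exp (φ * Complex.I)) := by
    fun_prop
  have hev : ∀ᶠ e : ℝ in 𝓝 0,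
      z + e * (Complex.I * Complex.exp (φ * Complex.I)) ∈ closedRay φ :=
    (hc.tendsto' 0 z (by simp)) (mem_interior_iff_mem_nhds.1 hz)
  obtain ⟨e, ⟨r', -, hr'⟩, he⟩ :=
    ((hev.filter_mono (nhdsWithin_le_nhds (s := {0}ᶜ))).and self_mem_nhdsWithin).exists
  have h1 : ((r : ℂ) + e * Complex.I) * Complex.exp (φ * Complex.I) =
      r' * Complex.exp (φ * Complex.I) := by
    rw [← hr', hr]; ring
  have h2 := congrArg Complex.im (mul_right_cancel₀ (Complex.exp_ne_zero _) h1)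
  simp at h2
  exact he h2

end Sector

/-! ### The sets 𝒢_Q and ℛ_Q. -/

section Operators

variable {X : Type*} [NormedAddCommGroup X] [NormedSpace ℂ X]

theorem mem_setR_iff {Q : X →L[ℂ] X} {z : ℂ} :
    z ∈ setR Q ↔ ∃ C : ℝ, ∀ s : ℂ, -(1 / 2 : ℝ) < s.re →
      ‖Ring.inverse (1 - s • (z • Q))‖ ≤ C := by
  simp only [smul_smul]
  constructor
  · intro h
    refine ⟨(⨆ (s : ℂ) (_ : -(1 / 2 : ℝ) < s.re),
      ‖Ring.inverse (1 - (s * z) • Q)‖ₑ).toReal, fun s hs => ?_⟩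
    rw [← toReal_enorm]
    exact ENNReal.toReal_mono (ne_of_lt h)
      (le_iSup₂ (f := fun (s : ℂ) (_ : -(1 / 2 : ℝ) < s.re) =>
        ‖Ring.inverse (1 - (s * z) • Q)‖ₑ) s hs)
  · rintro ⟨C, hC⟩
    refine lt_of_le_of_lt (iSup₂_le fun s hs => ?_) (ENNReal.ofReal_lt_top (r := C))
    rw [← ofReal_norm]
    exact ENNReal.ofReal_le_ofReal (hC s hs)

theorem zero_mem_setR (Q : X →L[ℂ] X) : (0 : ℂ) ∈ setR Q :=
  mem_setR_iff.2 ⟨‖(1 : X →L[ℂ] X)‖, fun s _ => by simp⟩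

theorem setR_zero : setR (0 : X →L[ℂ] X) = Set.univ :=
  Set.eq_univ_of_forall fun _ =>
    mem_setR_iff.2 ⟨‖(1 : X →L[ℂ] X)‖, fun s _ => by simp⟩

theorem isUnit_one_sub_smul {Q : X →L[ℂ] X} (hQ : spectrum ℂ Q = {0}) (s : ℂ) :
    IsUnit (1 - s • Q) := by
  rcases eq_or_ne s 0 with rfl | hs
  · simp
  · have h : s⁻¹ ∉ spectrum ℂ Q := by rw [hQ]; simpa using hs
    have h' := (spectrum.notMem_iff.1 h).smul (Units.mk0 s hs)
    rw [Units.smul_def, Units.val_mk0, Algebra.algebraMap_eq_smul_one, smul_sub, smul_smul,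
      mul_inv_cancel₀ hs, one_smul] at h'
    exact h'

theorem setR_mem_nhds {Q : X →L[ℂ] X} (hQ : ∀ s : ℂ, IsUnit (1 - s • Q)) {z : ℂ}
    (hz : z ∈ setR Q) (hz0 : z ≠ 0) : setR Q ∈ 𝓝 z := by
  obtain ⟨C, hC⟩ := mem_setR_iff.1 hz
  have hcont : Continuous fun v : ℂ => ‖v / z - 1‖ * (C + ‖(1 : X →L[ℂ] X)‖) := by fun_prop
  have hev : ∀ᶠ v in 𝓝 z, ‖v / z - 1‖ * (C + ‖(1 : X →L[ℂ] X)‖) < 1 / 2 :=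
    hcont.continuousAt.eventually (gt_mem_nhds (by simp [div_self hz0]))
  filter_upwards [hev] with v hv
  refine mem_setR_iff.2 ⟨2 * C, fun s hs => ?_⟩
  have e : s • (v • Q) = (s * (1 + (v / z - 1))) • (z • Q) := by
    rw [smul_smul, smul_smul]
    congr 1
    field_simp
    ring
  rw [e]
  exact norm_inverse_one_sub_perturb_le (by rw [smul_smul]; exact hQ _)
    (by rw [smul_smul]; exact hQ _) (hC s hs) hv.le

variable [CompleteSpace X]

/-- A finite upper limit controls large t; continuity on a compact interval controls the rest. -/
theorem mem_setG_iff {Q : X →L[ℂ] X} {z : ℂ} :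
    z ∈ setG Q ↔ ∃ M : ℝ, ∀ t : ℝ, 0 ≤ t → ‖NormedSpace.exp (((t : ℂ) * z) • Q)‖ ≤ M := by
  constructor
  · intro h
    have h' : Filter.limsup (fun t : ℝ => ‖NormedSpace.exp (((t : ℂ) * z) • Q)‖ₑ)
        Filter.atTop < ⊤ := h
    obtain ⟨b, hb, hbt⟩ := exists_between h'
    obtain ⟨T, hT⟩ := Filter.eventually_atTop.1 (Filter.eventually_lt_of_limsup_lt hb)
    have hcont : Continuous fun t : ℝ => NormedSpace.exp (((t : ℂ) * z) • Q) :=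
      (continuous_exp_smul Q).comp (by fun_prop : Continuous fun t : ℝ => (t : ℂ) * z)
    obtain ⟨K, hK⟩ := (isCompact_Icc (a := (0 : ℝ)) (b := T)).exists_bound_of_continuousOn
      hcont.continuousOn
    refine ⟨max K b.toReal, fun t ht => ?_⟩
    rcases le_total t T with h1 | h1
    · exact (hK t ⟨ht, h1⟩).trans (le_max_left _ _)
    · refine le_trans ?_ (le_max_right _ _)
      rw [← toReal_enorm]
      exact ENNReal.toReal_mono hbt.ne (hT t h1).le
  · rintro ⟨M, hM⟩
    refine lt_of_le_of_lt (Filter.limsup_le_of_le (by isBoundedDefault) ?_)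
      (ENNReal.ofReal_lt_top (r := M))
    filter_upwards [Filter.eventually_ge_atTop 0] with t ht
    rw [← ofReal_norm]
    exact ENNReal.ofReal_le_ofReal (hM t ht)

theorem add_mem_setG {Q : X →L[ℂ] X} {z w : ℂ} (hz : z ∈ setG Q) (hw : w ∈ setG Q) :
    z + w ∈ setG Q := by
  obtain ⟨M, hM⟩ := mem_setG_iff.1 hz
  obtain ⟨N, hN⟩ := mem_setG_iff.1 hw
  refine mem_setG_iff.2 ⟨M * N, fun t ht => ?_⟩
  rw [mul_add]
  refine (congrArg norm (exp_add_smul Q _ _)).le.trans ?_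
  exact (norm_mul_le _ _).trans (mul_le_mul (hM t ht) (hN t ht) (norm_nonneg _)
    ((norm_nonneg _).trans (hM t ht)))

theorem ofReal_mul_mem_setG {Q : X →L[ℂ] X} {z : ℂ} (hz : z ∈ setG Q) {r : ℝ} (hr : 0 ≤ r) :
    (r : ℂ) * z ∈ setG Q := by
  obtain ⟨M, hM⟩ := mem_setG_iff.1 hz
  refine mem_setG_iff.2 ⟨M, fun t ht => ?_⟩
  have := hM (t * r) (mul_nonneg ht hr)
  rwa [Complex.ofReal_mul, mul_assoc] at this

theorem eq_zero_of_neg_mem_setG {Q : X →L[ℂ] X} (hQ : ∀ s : ℂ, IsUnit (1 - s • Q)) {z : ℂ}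
    (hz0 : z ≠ 0) (hz : z ∈ setG Q) (hz' : -z ∈ setG Q) : Q = 0 := by
  obtain ⟨M, hM⟩ := mem_setG_iff.1 hz
  obtain ⟨N, hN⟩ := mem_setG_iff.1 hz'
  have := eq_zero_of_exp_bound (A := z • Q) (M := max M N)
    (fun s => by rw [smul_smul]; exact hQ _) (fun t => by
      rw [smul_smul]
      rcases le_total 0 t with ht | ht
      · exact (hM t ht).trans (le_max_left _ _)
      · have := hN (-t) (by linarith)
        rw [Complex.ofReal_neg, neg_mul_neg] at this
        exact this.trans (le_max_right _ _))
  exact (smul_eq_zero.1 this).resolve_left hz0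

theorem zero_notMem_interior_setG {Q : X →L[ℂ] X} (hQ : ∀ s : ℂ, IsUnit (1 - s • Q))
    (hQ0 : Q ≠ 0) : (0 : ℂ) ∉ interior (setG Q) := by
  intro h
  have h0 : ∀ᶠ z : ℂ in 𝓝 0, z ∈ setG Q := mem_interior_iff_mem_nhds.1 h
  have h1 : ∀ᶠ z : ℂ in 𝓝 0, z ∈ setG Q ∧ -z ∈ setG Q := by
    have hn : Filter.Tendsto (fun z : ℂ => -z) (𝓝 0) (𝓝 0) := by
      simpa using (continuous_neg (G := ℂ)).tendsto 0
    exact h0.and (hn.eventually h0)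
  have h2 := (h1.filter_mono (nhdsWithin_le_nhds (s := {0}ᶜ))).and self_mem_nhdsWithin
  obtain ⟨z, ⟨hz, hz'⟩, hz0⟩ := h2.exists
  exact hQ0 (eq_zero_of_neg_mem_setG hQ hz0 hz hz')

theorem setR_subset_setG {Q : X →L[ℂ] X} (hQ : ∀ s : ℂ, IsUnit (1 - s • Q)) :
    setR Q ⊆ setG Q := by
  intro z hz
  obtain ⟨C, hC⟩ := mem_setR_iff.1 hz
  have hpow := exists_norm_pow_le (A := z • Q) (fun s => by rw [smul_smul]; exact hQ _) hC
  refine mem_setG_iff.2 ⟨2 * Real.exp 1 * C ^ 2, fun t ht => ?_⟩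
  have := norm_exp_smul_le_of_norm_pow_le hpow ht
  rwa [smul_smul] at this

theorem mem_interior_setG_of_mem_setR {Q : X →L[ℂ] X} (hQ : ∀ s : ℂ, IsUnit (1 - s • Q)) {z : ℂ}
    (hz : z ∈ setR Q) (hz0 : z ≠ 0) : z ∈ interior (setG Q) :=
  mem_interior_iff_mem_nhds.2
    (Filter.mem_of_superset (setR_mem_nhds hQ hz hz0) (setR_subset_setG hQ))

theorem exists_exp_bound_of_mem_interior_setG {Q : X →L[ℂ] X} {z : ℂ}
    (hz : z ∈ interior (setG Q)) : ∃ ε M : ℝ, 0 < ε ∧ ε ≤ 1 ∧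
      (∀ t : ℝ, 0 ≤ t → ‖NormedSpace.exp (((t : ℂ) * (1 + ε * Complex.I)) • (z • Q))‖ ≤ M) ∧
      (∀ t : ℝ, 0 ≤ t → ‖NormedSpace.exp (((t : ℂ) * (1 - ε * Complex.I)) • (z • Q))‖ ≤ M) := by
  have hz' : ∀ᶠ v : ℂ in 𝓝 z, v ∈ setG Q := mem_interior_iff_mem_nhds.1 hz
  have h1 : Filter.Tendsto (fun ε : ℝ => (1 + ε * Complex.I) * z) (𝓝 0) (𝓝 z) := by
    have : Continuous fun ε : ℝ => (1 + ε * Complex.I) * z := by fun_prop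
    simpa using this.tendsto 0
  have h2 : Filter.Tendsto (fun ε : ℝ => (1 - ε * Complex.I) * z) (𝓝 0) (𝓝 z) := by
    have : Continuous fun ε : ℝ => (1 - ε * Complex.I) * z := by fun_prop
    simpa using this.tendsto 0
  have h3 : ∀ᶠ ε : ℝ in 𝓝 0, ((1 + ε * Complex.I) * z ∈ setG Q ∧
      (1 - ε * Complex.I) * z ∈ setG Q) ∧ ε ≤ 1 :=
    ((h1.eventually hz').and (h2.eventually hz')).and (eventually_le_nhds one_pos)
  obtain ⟨ε, ⟨⟨ha, hb⟩, hε1⟩, hε⟩ :=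
    ((h3.filter_mono (nhdsWithin_le_nhds (s := Set.Ioi 0))).and self_mem_nhdsWithin).exists
  obtain ⟨M, hM⟩ := mem_setG_iff.1 ha
  obtain ⟨N, hN⟩ := mem_setG_iff.1 hb
  refine ⟨ε, max M N, hε, hε1, fun t ht => ?_, fun t ht => ?_⟩
  · rw [smul_smul, mul_assoc]
    exact (hM t ht).trans (le_max_left _ _)
  · rw [smul_smul, mul_assoc]
    exact (hN t ht).trans (le_max_right _ _)

theorem mem_setR_of_mem_interior_setG {Q : X →L[ℂ] X} (hQ : ∀ s : ℂ, IsUnit (1 - s • Q)) {z : ℂ}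
    (hz : z ∈ interior (setG Q)) : z ∈ setR Q := by
  obtain ⟨ε, M, hε, hε1, h₁, h₂⟩ := exists_exp_bound_of_mem_interior_setG hz
  exact mem_setR_iff.2 (exists_norm_inverse_le_of_exp_bound
    (fun s => by rw [smul_smul]; exact hQ _) hε hε1 h₁ h₂)

/-! ### Bounded analytic semigroups. -/

theorem isC0Semigroup_expSemigroup (A : X →L[ℂ] X) : IsC0Semigroup (expSemigroup A) where
  map_zero := by simp [expSemigroup]
  map_add s t := by
    simp only [expSemigroup, NNReal.coe_add, Complex.ofReal_add]
    exact exp_add_smul A _ _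
  strongly_continuous x := by
    have : Continuous (expSemigroup A) :=
      (continuous_exp_smul A).comp (by fun_prop : Continuous fun t : ℝ≥0 => ((t : ℝ) : ℂ))
    exact this.clm_apply continuous_const

theorem isGeneratedBy_expSemigroup (A : X →L[ℂ] X) : IsGeneratedBy (expSemigroup A) A where
  semigroup := isC0Semigroup_expSemigroup A
  generator x := by
    have h1 : HasDerivAt (fun w : ℂ => NormedSpace.exp (w • A)) A 0 := by
      simpa using hasDerivAt_exp_smul_const A (0 : ℂ)
    have h2 : HasDerivAt (fun w : ℂ => NormedSpace.exp (w • A) x) (A x) 0 := by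
      simpa using h1.clm_apply (hasDerivAt_const (0 : ℂ) x)
    have h3 : Filter.Tendsto (fun t : ℝ≥0 => ((t : ℝ) : ℂ)) (𝓝[>] 0) (𝓝[≠] 0) := by
      refine tendsto_nhdsWithin_of_tendsto_nhds_of_eventually_within _ ?_ ?_
      · have : Continuous fun t : ℝ≥0 => ((t : ℝ) : ℂ) := by fun_prop
        exact (this.tendsto' 0 0 (by simp)).mono_left nhdsWithin_le_nhds
      · filter_upwards [self_mem_nhdsWithin] with t ht
        have : t ≠ 0 := ne_of_gt ht
        simpa using this
    refine ((hasDerivAt_iff_tendsto_slope.1 h2).comp h3).congr fun t => ?_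
    simp [slope_def_module, expSemigroup]

theorem generatesBoundedAnalyticSemigroup_of_exp_bound {A : X →L[ℂ] X} {ε M : ℝ} (hε : 0 < ε)
    (h₁ : ∀ t : ℝ, 0 ≤ t → ‖NormedSpace.exp (((t : ℂ) * (1 + ε * Complex.I)) • A)‖ ≤ M)
    (h₂ : ∀ t : ℝ, 0 ≤ t → ‖NormedSpace.exp (((t : ℂ) * (1 - ε * Complex.I)) • A)‖ ≤ M) :
    GeneratesBoundedAnalyticSemigroup A := by
  refine ⟨isGeneratedBy_expSemigroup A, Real.arctan ε, isC0Semigroup_expSemigroup A,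
    Real.arctan_pos.2 hε, (Real.arctan_lt_pi_div_two ε).le, fun θ' h0 hlt => ?_⟩
  refine ⟨fun w => NormedSpace.exp (w • A), (differentiable_exp_smul_const ℂ A).differentiableOn,
    ⟨M * M, fun w hw => ?_⟩, fun t _ => rfl⟩
  have hpi := hlt.trans (Real.arctan_lt_pi_div_two ε)
  rw [mem_sector_iff h0 hpi] at hw
  have hc : 0 < Real.cos θ' := Real.cos_pos_of_mem_Ioo ⟨by linarith, hpi⟩
  have hs : 0 < Real.sin θ' := Real.sin_pos_of_pos_of_lt_pi h0 (by linarith)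
  have hre : 0 < w.re := by nlinarith
  have htan : Real.tan θ' < ε := by
    have := Real.tan_lt_tan_of_lt_of_lt_pi_div_two (by linarith) (Real.arctan_lt_pi_div_two ε) hlt
    rwa [Real.tan_arctan] at this
  have hsin : Real.sin θ' < ε * Real.cos θ' := by
    rwa [Real.tan_eq_sin_div_cos, div_lt_iff₀ hc] at htan
  have hmul := mul_lt_mul_of_pos_right hsin hre
  have him1 : w.im < ε * w.re := lt_of_mul_lt_mul_right (by nlinarith) hc.le
  have him2 : -w.im < ε * w.re := lt_of_mul_lt_mul_right (by nlinarith) hc.le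
  have ha : 0 ≤ (w.re + w.im / ε) / 2 := by
    have : -w.im / ε < w.re := by rwa [div_lt_iff₀ hε, mul_comm]
    rw [neg_div] at this
    linarith
  have hb : 0 ≤ (w.re - w.im / ε) / 2 := by
    have : w.im / ε < w.re := by rwa [div_lt_iff₀ hε, mul_comm]
    linarith
  -- Inside the angle `arctan ε`, w is a nonnegative combination of 1 ± iε, so exp(wA) factors into
  -- two bounded exponentials.
  have e : w = (((w.re + w.im / ε) / 2 : ℝ) : ℂ) * (1 + ε * Complex.I) +
      (((w.re - w.im / ε) / 2 : ℝ) : ℂ) * (1 - ε * Complex.I) := by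
    apply Complex.ext
    · simp; ring
    · simp; field_simp; ring
  rw [e]
  refine (congrArg norm (exp_add_smul A _ _)).le.trans ?_
  exact (norm_mul_le _ _).trans (mul_le_mul (h₁ _ ha) (h₂ _ hb) (norm_nonneg _)
    ((norm_nonneg _).trans (h₁ 0 le_rfl)))

theorem mem_interior_setG_of_generates {Q : X →L[ℂ] X} {z : ℂ} (hz0 : z ≠ 0)
    (h : GeneratesBoundedAnalyticSemigroup (z • Q)) : z ∈ interior (setG Q) := by
  obtain ⟨-, θ, hθ⟩ := h
  have h0 : 0 < θ / 2 := half_pos hθ.angle_pos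
  have h1 : θ / 2 < Real.pi / 2 := by linarith [hθ.angle_le, hθ.angle_pos]
  obtain ⟨F, hF, ⟨C, hC⟩, hFS⟩ := hθ.extension (θ / 2) h0 (half_lt_self hθ.angle_pos)
  have hopen := isOpen_sector h0 h1
  -- The identity theorem: both functions are analytic and agree on the positive reals, which
  -- accumulate at 1.
  have heq : Set.EqOn F (fun w => NormedSpace.exp (w • (z • Q))) (sector (θ / 2)) := by
    have hone : ((1 : ℝ) : ℂ) ∈ sector (θ / 2) := ofReal_mem_sector h0 one_pos
    refine AnalyticOnNhd.eqOn_of_preconnected_of_frequently_eq (hF.analyticOnNhd hopen)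
      ((differentiable_exp_smul_const ℂ (z • Q)).differentiableOn.analyticOnNhd hopen)
      (convex_sector h0 h1).isPreconnected hone ?_
    have ht : Filter.Tendsto (fun t : ℝ => (t : ℂ)) (𝓝[≠] 1) (𝓝[≠] ((1 : ℝ) : ℂ)) :=
      Complex.continuous_ofReal.continuousAt.continuousWithinAt.tendsto_nhdsWithin
        fun t ht => by simpa using ht
    refine ht.frequently (Filter.Eventually.frequently ?_)
    filter_upwards [nhdsWithin_le_nhds (lt_mem_nhds one_pos)] with t htpos
    exact hFS ⟨t, htpos.le⟩ htpos
  have hU : (fun v : ℂ => v / z) ⁻¹' sector (θ / 2) ∈ 𝓝 z := by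
    refine (hopen.preimage (by fun_prop)).mem_nhds ?_
    simpa [div_self hz0] using ofReal_mem_sector h0 one_pos
  refine mem_interior_iff_mem_nhds.2 (Filter.mem_of_superset hU fun v hv => ?_)
  refine mem_setG_iff.2 ⟨max C ‖(1 : X →L[ℂ] X)‖, fun t ht => ?_⟩
  rcases ht.eq_or_lt with rfl | ht
  · simp
  · have hmem := ofReal_mul_mem_sector ht hv
    have e : ((t : ℂ) * v) • Q = ((t : ℂ) * (v / z)) • (z • Q) := by
      rw [smul_smul]
      congr 1
      field_simp
    have hval := heq hmem
    rw [e]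
    simp only at hval
    rw [← hval]
    exact (hC _ hmem).trans (le_max_left _ _)

/-! ### The equivalences and the ray criterion. -/

theorem tfae_mem_interior_setG {Q : X →L[ℂ] X} (hQ : ∀ s : ℂ, IsUnit (1 - s • Q)) {z : ℂ}
    (hz : Q ≠ 0 ∨ z ≠ 0) :
    List.TFAE [
      z ∈ interior (setG Q),
      z ≠ 0 ∧ GeneratesBoundedAnalyticSemigroup (z • Q),
      z ∈ setR Q \ {0}] := by
  have hne : z ∈ interior (setG Q) → z ≠ 0 := by
    rintro h rfl
    exact zero_notMem_interior_setG hQ (hz.resolve_right (not_not.2 rfl)) h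
  tfae_have 1 → 2 := fun h => by
    obtain ⟨ε, M, hε, -, h₁, h₂⟩ := exists_exp_bound_of_mem_interior_setG h
    exact ⟨hne h, generatesBoundedAnalyticSemigroup_of_exp_bound hε h₁ h₂⟩
  tfae_have 2 → 1 := fun h => mem_interior_setG_of_generates h.1 h.2
  tfae_have 1 → 3 := fun h => ⟨mem_setR_of_mem_interior_setG hQ h, hne h⟩
  tfae_have 3 → 1 := fun h => mem_interior_setG_of_mem_setR hQ h.1 h.2
  tfae_finish

theorem setR_eq_interior_setG_union {Q : X →L[ℂ] X} (hQ : ∀ s : ℂ, IsUnit (1 - s • Q)) :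
    setR Q = interior (setG Q) ∪ {0} := by
  ext z
  constructor
  · intro hz
    by_cases hz0 : z = 0
    · exact Or.inr hz0
    · exact Or.inl (mem_interior_setG_of_mem_setR hQ hz hz0)
  · rintro (hz | rfl)
    · exact mem_setR_of_mem_interior_setG hQ hz
    · exact zero_mem_setR Q

theorem interior_setG_nonempty_of_im_ne_zero {Q : X →L[ℂ] X} {z w : ℂ} (hz0 : z ≠ 0)
    (hz : z ∈ setG Q) (hw : w ∈ setG Q) (him : (w / z).im ≠ 0) :
    (interior (setG Q)).Nonempty := by
  refine ⟨z + w, mem_interior_iff_mem_nhds.2 ?_⟩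
  -- a and b are the real coordinates in the basis z, w. Both equal 1 at z + w, hence stay positive
  -- nearby, and the convex cone 𝒢_Q contains such v.
  set b : ℂ → ℝ := fun v => (v / z).im / (w / z).im with hb
  set a : ℂ → ℝ := fun v => (v / z).re - b v * (w / z).re with ha
  have hbc : Continuous b :=
    (Complex.continuous_im.comp (continuous_id.div_const z)).div_const _
  have hac : Continuous a :=
    (Complex.continuous_re.comp (continuous_id.div_const z)).sub (hbc.mul continuous_const)
  have hb1 : b (z + w) = 1 := by simp [hb, add_div, div_self hz0, div_self him]
  have ha1 : a (z + w) = 1 := by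
    rw [ha]
    simp only [hb1]
    simp [add_div, div_self hz0]
  have hev : ∀ᶠ v in 𝓝 (z + w), 0 < a v ∧ 0 < b v :=
    (hac.continuousAt.eventually (lt_mem_nhds (by rw [ha1]; exact one_pos))).and
      (hbc.continuousAt.eventually (lt_mem_nhds (by rw [hb1]; exact one_pos)))
  filter_upwards [hev] with v hv
  have e : v = (a v : ℂ) * z + (b v : ℂ) * w := by
    have h : v / z = (a v : ℂ) + (b v : ℂ) * (w / z) := by
      apply Complex.ext
      · simp [ha]
      · simp [hb, div_mul_cancel₀ _ him]
    rw [div_eq_iff hz0] at h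
    rwa [add_mul, mul_assoc, div_mul_cancel₀ _ hz0] at h
  rw [e]
  exact add_mem_setG (ofReal_mul_mem_setG hz hv.1.le) (ofReal_mul_mem_setG hw hv.2.le)

theorem exists_subset_closedRay_of_interior_eq_empty {Q : X →L[ℂ] X}
    (hQ : ∀ s : ℂ, IsUnit (1 - s • Q)) (hQ0 : Q ≠ 0) (hint : interior (setG Q) = ∅) :
    ∃ φ ∈ Set.Ico (-Real.pi) Real.pi, setG Q ⊆ closedRay φ := by
  by_cases hG : ∃ z ∈ setG Q, z ≠ 0
  · obtain ⟨z, hz, hz0⟩ := hG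
    obtain ⟨φ, hφ, hzφ⟩ : ∃ φ ∈ Set.Ico (-Real.pi) Real.pi,
        (‖z‖ : ℂ) * Complex.exp (φ * Complex.I) = z := by
      rcases (Complex.arg_le_pi z).eq_or_lt with h | h
      -- `Complex.arg` takes values in (-π, π], so π is replaced by -π.
      · refine ⟨-Real.pi, ⟨le_rfl, by linarith [Real.pi_pos]⟩, ?_⟩
        have h2 := Complex.norm_mul_exp_arg_mul_I z
        rw [h, Complex.exp_pi_mul_I] at h2
        rw [Complex.ofReal_neg, neg_mul, Complex.exp_neg, Complex.exp_pi_mul_I]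
        simpa using h2
      · exact ⟨z.arg, ⟨(Complex.neg_pi_lt_arg z).le, h⟩, Complex.norm_mul_exp_arg_mul_I z⟩
    refine ⟨φ, hφ, fun w hw => ?_⟩
    have him : (w / z).im = 0 := by
      by_contra him
      exact (interior_setG_nonempty_of_im_ne_zero hz0 hz hw him).ne_empty hint
    have hwz : w = ((w / z).re : ℂ) * z := by
      have : w / z = ((w / z).re : ℂ) := Complex.ext (by simp) (by simpa using him)
      rw [← this, div_mul_cancel₀ _ hz0]
    rcases le_or_gt 0 (w / z).re with hr | hr
    · refine ⟨(w / z).re * ‖z‖, by positivity, ?_⟩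
      rw [Complex.ofReal_mul, mul_assoc, hzφ]
      exact hwz
    -- A negative ratio w/z would put -z in the cone, and Gelfand's theorem would force Q = 0.
    · refine absurd (eq_zero_of_neg_mem_setG hQ hz0 hz ?_) hQ0
      have h1 := ofReal_mul_mem_setG hw (r := (-(w / z).re)⁻¹) (by
        rw [inv_nonneg]; linarith)
      have hrC : ((w / z).re : ℂ) ≠ 0 := by exact_mod_cast hr.ne
      have e : (((-(w / z).re)⁻¹ : ℝ) : ℂ) * w = -z := by
        conv_lhs => rw [hwz]
        push_cast
        rw [mul_div_cancel_right₀ _ hz0, Complex.ofReal_re, ← mul_assoc, inv_neg, neg_mul,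
          inv_mul_cancel₀ hrC, neg_one_mul]
      rwa [e] at h1
  · push Not at hG
    exact ⟨0, ⟨by linarith [Real.pi_pos], Real.pi_pos⟩, fun w hw => ⟨0, le_rfl, by simp [hG w hw]⟩⟩

theorem setR_eq_singleton_iff {Q : X →L[ℂ] X} (hQ : ∀ s : ℂ, IsUnit (1 - s • Q)) :
    setR Q = {0} ↔ ∃ φ ∈ Set.Ico (-Real.pi) Real.pi, setG Q ⊆ closedRay φ := by
  constructor
  · intro hR
    have hQ0 : Q ≠ 0 := by
      rintro rfl
      have h1 : (1 : ℂ) ∈ setR (0 : X →L[ℂ] X) := by rw [setR_zero]; trivial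
      rw [hR] at h1
      exact one_ne_zero h1
    refine exists_subset_closedRay_of_interior_eq_empty hQ hQ0
      (Set.eq_empty_iff_forall_notMem.2 fun z hz => ?_)
    have hzR := mem_setR_of_mem_interior_setG hQ hz
    rw [hR, Set.mem_singleton_iff] at hzR
    exact zero_notMem_interior_setG hQ hQ0 (hzR ▸ hz)
  · rintro ⟨φ, -, hφ⟩
    have : interior (setG Q) = ∅ :=
      Set.subset_empty_iff.1 ((interior_mono hφ).trans (interior_closedRay φ).subset)
    rw [setR_eq_interior_setG_union hQ, this, Set.empty_union]

end Operators

end QuasiSemigroup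

theorem theorem4p3 {X : Type*} [NormedAddCommGroup X] [NormedSpace ℂ X] [CompleteSpace X]
    (Q : X →L[ℂ] X) (hQ : spectrum ℂ Q = {0}) :
    (∀ z : ℂ, (Q ≠ 0 ∨ z ≠ 0) →
      List.TFAE [
        z ∈ interior (QuasiSemigroup.setG Q),
        z ≠ 0 ∧ QuasiSemigroup.GeneratesBoundedAnalyticSemigroup (z • Q),
        z ∈ QuasiSemigroup.setR Q \ {0}]) ∧
    QuasiSemigroup.setR Q = interior (QuasiSemigroup.setG Q) ∪ {0} ∧
    (QuasiSemigroup.setR Q = {0} ↔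
      ∃ φ ∈ Set.Ico (-Real.pi) Real.pi,
        QuasiSemigroup.setG Q ⊆ QuasiSemigroup.closedRay φ) := by
  have hu := QuasiSemigroup.isUnit_one_sub_smul hQ
  exact ⟨fun _ hz => QuasiSemigroup.tfae_mem_interior_setG hu hz,
    QuasiSemigroup.setR_eq_interior_setG_union hu, QuasiSemigroup.setR_eq_singleton_iff hu⟩
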